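/- Let $n\ge 2$ and let $H^2(\mathbb{D}^n)$ be the Hardy module over the polydisc, that is, the closure of $\mathbb{C}[z_1,\dots,z_n]$ in $L^2(\mathbb{T}^n)$ with the operators $M_{z_1},\dots,M_{z_n}$ of multiplication by the coordinate functions. Let $\Theta_1,\dots,\Theta_n\in H^\infty(\mathbb{D})$ be non-constant inner functions (bounded holomorphic functions on the unit disc $\mathbb{D}$ whose radial limits have modulus one almost everywhere on the circle), put $\tilde\Theta_i(z)=\Theta_i(z_i)$ for $z\in\mathbb{D}^n$, and let \[\mathcal{S}_\Theta=\sum_{i=1}^n\tilde\Theta_i H^2(\mathbb{D}^n),\] where $\tilde\Theta_i$ acts on $H^2(\mathbb{D}^n)$ by multiplication with its boundary function. Then $\mathcal{S}_\Theta$ and $H^2(\mathbb{D}^n)$ are not unitarily equivalent: there is no unitary map $U:\mathcal{S}_\Theta\to H^2(\mathbb{D}^n)$ with $U(M_{z_i}|_{\mathcal{S}_\Theta})=M_{z_i}U$ for all $i=1,\dots,n$. -/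

import Mathlib

open MeasureTheory Filter Topology
open scoped ENNReal

noncomputable section

namespace HardyPolydisc

/-- Normalized Lebesgue measure on the torus `𝕋ⁿ`. A point `t` of `UnitAddTorus (Fin n)` stands for
the point `(e^{2πi t₁}, …, e^{2πi tₙ})` of `𝕋ⁿ`;
`fourier 1` is the function `s ↦ e^{2πi s}` on `ℝ/ℤ`. -/
abbrev torusMeasure (n : ℕ) : Measure (UnitAddTorus (Fin n)) :=
  Measure.pi fun _ => AddCircle.haarAddCircle

/-- The Hilbert space `L²(𝕋ⁿ)`. -/
abbrev L2 (n : ℕ) : Type := Lp ℂ 2 (torusMeasure n)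

/-- The coordinate function `z_i` on `𝕋ⁿ`. -/
def coord {n : ℕ} (i : Fin n) : C(UnitAddTorus (Fin n), ℂ) where
  toFun t := fourier 1 (t i)
  continuous_toFun :=
    (fourier 1).continuous.comp (continuous_apply i)

/-- The class in `L²(𝕋ⁿ)` of the restriction of a polynomial to `𝕋ⁿ`. -/
def polyToL2 (n : ℕ) : MvPolynomial (Fin n) ℂ →ₗ[ℂ] L2 n :=
  (ContinuousMap.toLp (E := ℂ) 2 (torusMeasure n) ℂ).toLinearMap ∘ₗ
    (MvPolynomial.aeval (R := ℂ) (coord (n := n))).toLinearMap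

/-- The Hardy space `H²(𝔻ⁿ)`: the closure of `ℂ[z₁, …, zₙ]` in `L²(𝕋ⁿ)`. -/
def hardy (n : ℕ) : Submodule ℂ (L2 n) :=
  (LinearMap.range (polyToL2 n)).topologicalClosure

/-- The operator `M_{z_i}` of multiplication by the coordinate function `z_i` on `L²(𝕋ⁿ)`. -/
def coordMul {n : ℕ} (i : Fin n) : L2 n →L[ℂ] L2 n :=
  (ContinuousLinearMap.mul ℂ ℂ).holderL (torusMeasure n) ∞ 2 2
    (ContinuousMap.toLp (E := ℂ) ∞ (torusMeasure n) ℂ (coord i))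

/-- Invariance of a subspace under all `M_{z_i}`. -/
def IsInvariant {n : ℕ} (S : Submodule ℂ (L2 n)) : Prop :=
  ∀ i : Fin n, ∀ f ∈ S, coordMul i f ∈ S

/-- The module operator `R_{z_i} = M_{z_i}|_S` on an invariant subspace `S`. -/
def restrictedMul {n : ℕ} {S : Submodule ℂ (L2 n)} (hS : IsInvariant S) (i : Fin n) : S →ₗ[ℂ] S :=
  (coordMul i).toLinearMap.restrict (hS i)

/-- Unitary equivalence of invariant subspaces as Hilbert modules over `ℂ[z₁, …, zₙ]`: a unitary
map that intertwines the module operators. -/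
def UnitarilyEquivalent {n : ℕ} (S₁ S₂ : Submodule ℂ (L2 n))
    (h₁ : IsInvariant S₁) (h₂ : IsInvariant S₂) : Prop :=
  ∃ U : S₁ ≃ₗᵢ[ℂ] S₂, ∀ (i : Fin n) (f : S₁),
    U (restrictedMul h₁ i f) = restrictedMul h₂ i (U f)

/-- Inner functions in `H^∞(𝔻)`: bounded holomorphic functions on the unit disc whose radial limits
exist and have modulus one at almost every point of the circle. -/
structure IsInner (θ : ℂ → ℂ) : Prop where
  holomorphic : DifferentiableOn ℂ θ (Metric.ball 0 1)
  bounded : ∃ C : ℝ, ∀ z ∈ Metric.ball (0 : ℂ) 1, ‖θ z‖ ≤ C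
  boundary : ∀ᵐ t : UnitAddCircle ∂AddCircle.haarAddCircle, ∃ w : ℂ, ‖w‖ = 1 ∧
    Tendsto (fun r : ℝ => θ ((r : ℂ) * fourier 1 t)) (𝓝[<] 1) (𝓝 w)

/-- The function `z ↦ θ (z_i)` of several variables. -/
def tilde {n : ℕ} (θ : ℂ → ℂ) (i : Fin n) : (Fin n → ℂ) → ℂ := fun z => θ (z i)

/-- The boundary function on `𝕋ⁿ` of a function on `𝔻ⁿ`, through radial limits
(a junk value where there is no radial limit). -/
def radialLimit {n : ℕ} (φ : (Fin n → ℂ) → ℂ) (t : UnitAddTorus (Fin n)) : ℂ :=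
  limUnder (𝓝[<] (1 : ℝ)) fun r : ℝ => φ fun j => (r : ℂ) * fourier 1 (t j)

/-- The subspace `φ M = {φ f : f ∈ M}` of `L²(𝕋ⁿ)`, where `φ` acts through its boundary function. -/
def mulImage {n : ℕ} (φ : (Fin n → ℂ) → ℂ) (M : Submodule ℂ (L2 n)) : Submodule ℂ (L2 n) where
  carrier := {g | ∃ f ∈ M, (g : UnitAddTorus (Fin n) → ℂ) =ᵐ[torusMeasure n]
    fun t => radialLimit φ t * f t}
  add_mem' := by
    rintro g₁ g₂ ⟨f₁, hf₁, h₁⟩ ⟨f₂, hf₂, h₂⟩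
    refine ⟨f₁ + f₂, M.add_mem hf₁ hf₂, ?_⟩
    filter_upwards [h₁, h₂, Lp.coeFn_add g₁ g₂, Lp.coeFn_add f₁ f₂] with t a b c d
    rw [c, d, Pi.add_apply, Pi.add_apply, a, b, mul_add]
  zero_mem' := by
    refine ⟨0, M.zero_mem, ?_⟩
    filter_upwards [Lp.coeFn_zero ℂ 2 (torusMeasure n)] with t a
    rw [a, Pi.zero_apply, mul_zero]
  smul_mem' := by
    rintro c g ⟨f, hf, h⟩
    refine ⟨c • f, M.smul_mem c hf, ?_⟩
    filter_upwards [h, Lp.coeFn_smul c g, Lp.coeFn_smul c f] with t a b d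
    rw [b, d, Pi.smul_apply, Pi.smul_apply, a, smul_eq_mul, smul_eq_mul, mul_left_comm]

/-- `S_Θ = ∑_{i=1}^n Θ̃_i H²(𝔻ⁿ)`, the algebraic sum, where `Θ̃_i(z) = Θ_i(z_i)`. -/
def sumModule {n : ℕ} (Θ : Fin n → ℂ → ℂ) : Submodule ℂ (L2 n) :=
  ⨆ i : Fin n, mulImage (tilde (Θ i) i) (hardy n)

theorem coordMul_coeFn {n : ℕ} (i : Fin n) (f : L2 n) :
    (coordMul i f : UnitAddTorus (Fin n) → ℂ) =ᵐ[torusMeasure n] fun t => coord i t * f t := by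
  have h1 := (ContinuousLinearMap.mul ℂ ℂ).coeFn_holder (μ := torusMeasure n) (p := ∞) (q := 2)
    (r := 2) (ContinuousMap.toLp (E := ℂ) ∞ (torusMeasure n) ℂ (coord i)) f
  have h2 := ContinuousMap.coeFn_toLp (p := ∞) (𝕜 := ℂ) (torusMeasure n) (coord i)
  filter_upwards [h1, h2] with t a b
  have : coordMul i f = (ContinuousLinearMap.mul ℂ ℂ).holder 2
    (ContinuousMap.toLp (E := ℂ) ∞ (torusMeasure n) ℂ (coord i)) f := rfl
  rw [this, a, b]
  rfl

theorem coordMul_polyToL2 {n : ℕ} (i : Fin n) (p : MvPolynomial (Fin n) ℂ) :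
    coordMul i (polyToL2 n p) = polyToL2 n (MvPolynomial.X i * p) := by
  apply Lp.ext
  have h1 := ContinuousMap.coeFn_toLp (p := 2) (𝕜 := ℂ) (torusMeasure n)
    (MvPolynomial.aeval (R := ℂ) (coord (n := n)) p)
  have h2 := ContinuousMap.coeFn_toLp (p := 2) (𝕜 := ℂ) (torusMeasure n)
    (MvPolynomial.aeval (R := ℂ) (coord (n := n)) (MvPolynomial.X i * p))
  filter_upwards [coordMul_coeFn i (polyToL2 n p), h1, h2] with t a b c
  have e1 : (polyToL2 n p : UnitAddTorus (Fin n) → ℂ) t =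
    MvPolynomial.aeval (R := ℂ) (coord (n := n)) p t := b
  have e2 : (polyToL2 n (MvPolynomial.X i * p) : UnitAddTorus (Fin n) → ℂ) t =
    MvPolynomial.aeval (R := ℂ) (coord (n := n)) (MvPolynomial.X i * p) t := c
  rw [a, e1, e2, map_mul, MvPolynomial.aeval_X, ContinuousMap.mul_apply]

theorem isInvariant_hardy (n : ℕ) : IsInvariant (hardy n) := by
  intro i f hf
  refine map_mem_closure (coordMul i).continuous hf ?_
  rintro _ ⟨p, rfl⟩
  exact ⟨MvPolynomial.X i * p, (coordMul_polyToL2 i p).symm⟩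

theorem isInvariant_mulImage {n : ℕ} (φ : (Fin n → ℂ) → ℂ) {M : Submodule ℂ (L2 n)}
    (hM : IsInvariant M) : IsInvariant (mulImage φ M) := by
  rintro i g ⟨f, hf, h⟩
  refine ⟨coordMul i f, hM i f hf, ?_⟩
  filter_upwards [h, coordMul_coeFn i g, coordMul_coeFn i f] with t a b c
  rw [b, c, a, mul_left_comm]

theorem isInvariant_sumModule {n : ℕ} (Θ : Fin n → ℂ → ℂ) : IsInvariant (sumModule Θ) := by
  intro i f hf
  have h : sumModule Θ ≤ (sumModule Θ).comap (coordMul i).toLinearMap :=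
    iSup_le fun j g hg => Submodule.mem_iSup_of_mem j
      (isInvariant_mulImage (tilde (Θ j) j) (isInvariant_hardy n) i g hg)
  exact h hf

end HardyPolydisc

end

open MeasureTheory Filter Topology
open scoped ENNReal ComplexConjugate
open UnitAddTorus

noncomputable section

namespace HardyPolydisc

/-! ### One variable: radial boundary values of inner functions. -/

section Disc

/-! Suppose `U` is a unitary module map from `S_Θ` onto `H²`, and let `ψ = U⁻¹ 1`. Comparing the
inner products of `z^α ψ` and `z^β Θ̃ᵢ` before and after `U` shows that `conj ψ · Θ̃ᵢ` and `U Θ̃ᵢ`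
have the same Fourier coefficients, hence agree (`conj_mul_ae_eq_of_unitary`). So `conj ψ = conj Θ̃ᵢ
· Fᵢ` with `Fᵢ ∈ H²`, for every `i`.

Since `Θ̃ᵢ` depends on `zᵢ` alone, this makes `conj ψ` analytic in each `z_j` with `j ≠ i`; as `n ≥
2`, every `j` admits such an `i`. But `ψ` lies in `S_Θ ⊆ H²`, so `conj ψ` is also anti-analytic in
each variable, and `ψ` must be constant. The only constant in `S_Θ` is zero
(`eq_zero_of_ae_eq_const_of_mem_sumModule`, where non-constancy enters as `|Θᵢ(0)| ≠ 1`), whereas `U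
ψ = 1`.

Orthogonality is expressed throughout by the bilinear pairing `∫ k f`, without conjugation. -/

theorem norm_fourier_apply (k : ℤ) (s : UnitAddCircle) : ‖(fourier k s : ℂ)‖ = 1 := by
  rw [fourier_apply, Circle.norm_coe]

theorem fourier_mul_fourier (k l : ℤ) (s : UnitAddCircle) :
    (fourier k s : ℂ) * fourier l s = fourier (k + l) s := fourier_add.symm

theorem fourier_one_pow (k : ℕ) (s : UnitAddCircle) :
    (fourier 1 s : ℂ) ^ k = fourier (k : ℤ) s := by
  induction k with
  | zero => simp
  | succ k ih => rw [pow_succ, ih, fourier_mul_fourier, Nat.cast_succ]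

/-- The integral of a function over the circle of radius `r`, as an integral over `ℝ/ℤ`. -/
theorem integral_radial (f : ℂ → ℂ) (r : ℝ) :
    ∫ s : UnitAddCircle, f (r * fourier 1 s) ∂AddCircle.haarAddCircle
      = Real.circleAverage f 0 r := by
  rw [AddCircle.integral_haarAddCircle, inv_one, one_smul,
    ← UnitAddCircle.intervalIntegral_preimage 0, Real.circleAverage_def]
  have h := intervalIntegral.smul_integral_comp_mul_left (a := 0) (b := 1)
    (fun θ => f (circleMap 0 r θ)) (2 * Real.pi)
  rw [mul_zero, mul_one] at h
  rw [← h, smul_smul, inv_mul_cancel₀ (by positivity), one_smul, zero_add]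
  refine intervalIntegral.integral_congr fun x _ => ?_
  simp only [fourier_coe_apply, circleMap, zero_add]
  congr 3
  push_cast
  ring

/-- **Cauchy's formula** on the unit circle for a bounded holomorphic function on the disc, in
terms of its radial limits. -/
theorem cauchy_radialLimit {F : ℂ → ℂ} (hF : DifferentiableOn ℂ F (Metric.ball 0 1))
    {C : ℝ} (hC : ∀ z ∈ Metric.ball (0 : ℂ) 1, ‖F z‖ ≤ C) {B : UnitAddCircle → ℂ}
    (hB : ∀ᵐ s ∂AddCircle.haarAddCircle,
      Tendsto (fun r : ℝ => F ((r : ℂ) * fourier 1 s)) (𝓝[<] 1) (𝓝 (B s)))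
    {w : ℂ} (hw : ‖w‖ < 1) :
    ∫ s, fourier 1 s / (fourier 1 s - w) * B s ∂AddCircle.haarAddCircle = F w := by
  -- Radii beyond the midpoint of `‖w‖` and `1` keep the Cauchy kernel bounded uniformly in `r`,
  -- which gives the dominating constant.
  have hev : ∀ᶠ r : ℝ in 𝓝[<] 1, (1 + ‖w‖) / 2 < r ∧ r < 1 :=
    Ioo_mem_nhdsLT (by linarith)
  have hnorm : ∀ (r : ℝ), 0 ≤ r → ∀ s : UnitAddCircle, ‖(r : ℂ) * fourier 1 s‖ = r := by
    intro r hr s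
    rw [norm_mul, norm_fourier_apply, mul_one, Complex.norm_real, Real.norm_of_nonneg hr]
  have hne : ∀ s : UnitAddCircle, (fourier 1 s : ℂ) - w ≠ 0 := by
    intro s h
    rw [sub_eq_zero] at h
    rw [← h, norm_fourier_apply] at hw
    exact lt_irrefl _ hw
  have hlow : ∀ r : ℝ, (1 + ‖w‖) / 2 < r → ∀ s : UnitAddCircle,
      (1 - ‖w‖) / 2 ≤ ‖(r : ℂ) * fourier 1 s - w‖ := by
    intro r hr s
    have := norm_sub_norm_le ((r : ℂ) * fourier 1 s) w
    rw [hnorm r (by linarith [norm_nonneg w])] at this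
    linarith
  have hlim : Tendsto (fun r : ℝ => ∫ s : UnitAddCircle,
      ((r : ℂ) * fourier 1 s) / ((r : ℂ) * fourier 1 s - w) * F ((r : ℂ) * fourier 1 s)
        ∂AddCircle.haarAddCircle) (𝓝[<] 1)
      (𝓝 (∫ s, fourier 1 s / (fourier 1 s - w) * B s ∂AddCircle.haarAddCircle)) := by
    refine tendsto_integral_filter_of_dominated_convergence
      (fun _ => 1 / ((1 - ‖w‖) / 2) * C) ?_ ?_ (integrable_const _) ?_
    · filter_upwards [hev] with r hr
      refine Continuous.aestronglyMeasurable ?_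
      have h1 : Continuous fun s : UnitAddCircle => (r : ℂ) * fourier 1 s := by fun_prop
      refine (h1.div (h1.sub continuous_const) fun s h => ?_).mul
        (hF.continuousOn.comp_continuous h1 fun s => ?_)
      · have := hlow r hr.1 s
        rw [show (r : ℂ) * fourier 1 s - w = 0 from h, norm_zero] at this
        linarith
      · rw [mem_ball_zero_iff, hnorm r (by linarith [norm_nonneg w])]
        exact hr.2
    · filter_upwards [hev] with r hr
      refine ae_of_all _ fun s => ?_
      have h0 : 0 ≤ r := by linarith [norm_nonneg w]
      rw [norm_mul, norm_div, hnorm r h0]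
      have h1 := hC ((r : ℂ) * fourier 1 s) (by rw [mem_ball_zero_iff, hnorm r h0]; exact hr.2)
      have h2 := hlow r hr.1 s
      have h3 : 0 < (1 - ‖w‖) / 2 := by linarith
      gcongr
      exact hr.2.le
    · filter_upwards [hB] with s hs
      refine Tendsto.mul ?_ hs
      have h1 : Tendsto (fun r : ℝ => (r : ℂ) * fourier 1 s) (𝓝[<] 1) (𝓝 (fourier 1 s)) := by
        have : Continuous fun r : ℝ => (r : ℂ) * fourier 1 s := by fun_prop
        simpa using (this.tendsto 1).mono_left nhdsWithin_le_nhds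
      exact h1.div (h1.sub_const w) (hne s)
  -- By Cauchy's formula on the circle of radius `r > ‖w‖`, the integrals converging in `hlim` are
  -- all equal to `F w`.
  refine tendsto_nhds_unique hlim (tendsto_const_nhds.congr' ?_)
  filter_upwards [hev] with r hr
  have h0 : 0 < r := by linarith [norm_nonneg w]
  have h1 := integral_radial (fun z => z / (z - w) * F z) r
  rw [h1]
  have h2 : DiffContOnCl ℂ F (Metric.ball 0 |r|) := by
    refine (hF.mono ?_).diffContOnCl
    rw [abs_of_pos h0, closure_ball _ h0.ne']
    exact Metric.closedBall_subset_ball hr.2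
  have h3 := h2.circleAverage_smul_div (w := w)
    (by rw [mem_ball_zero_iff, abs_of_pos h0]; linarith [norm_nonneg w])
  simpa using h3.symm

/-- The boundary function on the circle of a function on the disc, through radial limits. -/
def boundaryFn (θ : ℂ → ℂ) (s : UnitAddCircle) : ℂ :=
  limUnder (𝓝[<] (1 : ℝ)) fun r : ℝ => θ ((r : ℂ) * fourier 1 s)

theorem radialLimit_tilde {n : ℕ} (θ : ℂ → ℂ) (i : Fin n) (t : UnitAddTorus (Fin n)) :
    radialLimit (tilde θ i) t = boundaryFn θ (t i) := rfl

variable {θ : ℂ → ℂ}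

theorem IsInner.ae_tendsto (h : IsInner θ) : ∀ᵐ s ∂AddCircle.haarAddCircle,
    Tendsto (fun r : ℝ => θ ((r : ℂ) * fourier 1 s)) (𝓝[<] 1) (𝓝 (boundaryFn θ s)) := by
  filter_upwards [h.boundary] with s ⟨w, _, hw⟩
  exact tendsto_nhds_limUnder ⟨w, hw⟩

theorem IsInner.norm_boundaryFn (h : IsInner θ) :
    ∀ᵐ s ∂AddCircle.haarAddCircle, ‖boundaryFn θ s‖ = 1 := by
  filter_upwards [h.boundary] with s ⟨w, h1, hw⟩
  rw [boundaryFn, hw.limUnder_eq, h1]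

theorem IsInner.aestronglyMeasurable (h : IsInner θ) :
    AEStronglyMeasurable (boundaryFn θ) AddCircle.haarAddCircle := by
  obtain ⟨u, -, hu, hlim⟩ := exists_seq_strictMono_tendsto' (show (0 : ℝ) < 1 by norm_num)
  have hlim' : Tendsto u atTop (𝓝[<] 1) :=
    tendsto_nhdsWithin_iff.2 ⟨hlim, Eventually.of_forall fun k => (hu k).2⟩
  refine aestronglyMeasurable_of_tendsto_ae atTop
    (f := fun k s => θ ((u k : ℂ) * fourier 1 s)) (fun k => ?_) ?_
  · refine Continuous.aestronglyMeasurable (h.holomorphic.continuousOn.comp_continuous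
      (by fun_prop) fun s => ?_)
    rw [mem_ball_zero_iff, norm_mul, norm_fourier_apply, mul_one, Complex.norm_real,
      Real.norm_of_nonneg (hu k).1.le]
    exact (hu k).2
  · filter_upwards [h.ae_tendsto] with s hs
    exact hs.comp hlim'

theorem IsInner.memLp (h : IsInner θ) (p : ℝ≥0∞) :
    MemLp (boundaryFn θ) p AddCircle.haarAddCircle :=
  MemLp.of_bound h.aestronglyMeasurable 1 (h.norm_boundaryFn.mono fun _ hs => hs.le)

/-- Cauchy's formula at the origin for `z ^ k * θ z`; the convention `0 ^ 0 = 1` covers the mean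
value as well. -/
theorem IsInner.integral_fourier_mul (h : IsInner θ) (k : ℕ) :
    ∫ s, fourier (k : ℤ) s * boundaryFn θ s ∂AddCircle.haarAddCircle = 0 ^ k * θ 0 := by
  obtain ⟨C, hC⟩ := h.bounded
  have := cauchy_radialLimit (F := fun z => z ^ k * θ z) (C := C)
    (B := fun s => fourier (k : ℤ) s * boundaryFn θ s) (w := 0)
    ((differentiable_id.pow k).differentiableOn.mul h.holomorphic) (fun z hz => ?_) ?_ (by simp)
  · rw [← this]
    refine integral_congr_ae (ae_of_all _ fun s => ?_)
    have : (fourier 1 s : ℂ) ≠ 0 := norm_pos_iff.1 (by rw [norm_fourier_apply]; exact one_pos)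
    simp only
    rw [sub_zero, div_self this, one_mul]
  · have h1 : ‖z‖ ^ k ≤ 1 := pow_le_one₀ (norm_nonneg _) (mem_ball_zero_iff.1 hz).le
    rw [norm_mul, norm_pow]
    calc ‖z‖ ^ k * ‖θ z‖ ≤ 1 * C := by gcongr; exact hC z hz
      _ = C := one_mul C
  · filter_upwards [h.ae_tendsto] with s hs
    refine Tendsto.mul ?_ hs
    have : Continuous fun r : ℝ => ((r : ℂ) * fourier 1 s) ^ k := by fun_prop
    have h1 := (this.tendsto 1).mono_left (nhdsWithin_le_nhds (s := Set.Iio 1))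
    rwa [Complex.ofReal_one, one_mul, fourier_one_pow] at h1

/-- A nonconstant inner function does not take a unimodular value at the origin. -/
theorem IsInner.norm_apply_zero_ne_one (h : IsInner θ)
    (hnc : ¬ ∃ c : ℂ, ∀ z ∈ Metric.ball (0 : ℂ) 1, θ z = c) : ‖θ 0‖ ≠ 1 := by
  intro h1
  refine hnc ⟨θ 0, fun z hz => ?_⟩
  have hint := h.memLp 1 |>.integrable le_rfl
  have hmean : ∫ s, boundaryFn θ s ∂AddCircle.haarAddCircle = θ 0 := by
    simpa using h.integral_fourier_mul 0
  have hre : Integrable (fun s => (conj (θ 0) * boundaryFn θ s).re) AddCircle.haarAddCircle :=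
    (hint.const_mul (conj (θ 0))).re
  -- When `‖θ 0‖ = 1` this integrand is `|boundaryFn θ - θ 0|²` almost everywhere, so its zero
  -- integral forces the boundary function to be constant.
  have hsq : ∫ s, (2 - 2 * (conj (θ 0) * boundaryFn θ s).re) ∂AddCircle.haarAddCircle = 0 := by
    have h2 : ∫ s, (conj (θ 0) * boundaryFn θ s).re ∂AddCircle.haarAddCircle = 1 := by
      have := integral_re (𝕜 := ℂ) (hint.const_mul (conj (θ 0)))
      simp only [RCLike.re_to_complex] at this
      rw [this, integral_const_mul, hmean, ← Complex.normSq_eq_conj_mul_self,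
        Complex.normSq_eq_norm_sq, h1]
      simp
    rw [integral_sub (integrable_const _) (hre.const_mul 2), integral_const_mul, h2]
    simp
  have hnn : ∀ᵐ s ∂AddCircle.haarAddCircle,
      2 - 2 * (conj (θ 0) * boundaryFn θ s).re = ‖boundaryFn θ s - θ 0‖ ^ 2 := by
    filter_upwards [h.norm_boundaryFn] with s hs
    rw [← Complex.normSq_eq_norm_sq, Complex.normSq_sub, Complex.normSq_eq_norm_sq,
      Complex.normSq_eq_norm_sq, hs, h1, mul_comm (conj _)]
    ring
  rw [integral_congr_ae hnn, integral_eq_zero_iff_of_nonneg (fun s => by positivity)] at hsq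
  · have hb : ∀ᵐ s ∂AddCircle.haarAddCircle, boundaryFn θ s = θ 0 := by
      filter_upwards [hsq] with s hs
      simpa [sub_eq_zero] using hs
    obtain ⟨C, hC⟩ := h.bounded
    -- A bounded holomorphic function with zero boundary values vanishes on the disc.
    have := cauchy_radialLimit (F := fun z => θ z - θ 0) (C := C + ‖θ 0‖) (B := fun _ => 0)
      (w := z) (h.holomorphic.sub_const _)
      (fun z hz => (norm_sub_le _ _).trans (by gcongr; exact hC z hz)) ?_ (mem_ball_zero_iff.1 hz)
    · simpa [sub_eq_zero] using this.symm
    · filter_upwards [h.ae_tendsto, hb] with s h2 h3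
      rw [h3] at h2
      simpa using h2.sub_const (θ 0)
  · exact Integrable.congr ((integrable_const _).sub (hre.const_mul 2)) hnn

end Disc

/-! ### Fourier coefficients on the torus and module maps. -/

section Torus

variable {n : ℕ}

theorem integral_fourier_eq_zero {k : ℤ} (hk : k ≠ 0) :
    ∫ s : UnitAddCircle, (fourier k s : ℂ) ∂AddCircle.haarAddCircle = 0 := by
  have := congrFun (fourierCoeff_fourier (T := 1) k) 0
  simpa [fourierCoeff, Pi.single_eq_of_ne hk.symm] using this

theorem norm_mFourier_apply (m : Fin n → ℤ) (t : UnitAddTorus (Fin n)) : ‖mFourier m t‖ = 1 := by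
  simp [mFourier, norm_prod, norm_fourier_apply, -fourier_apply]

theorem memLp_mul_mFourier {k : UnitAddTorus (Fin n) → ℂ} {p : ℝ≥0∞}
    (hk : MemLp k p (torusMeasure n)) (m : Fin n → ℤ) :
    MemLp (fun t => k t * mFourier m t) p (torusMeasure n) :=
  hk.of_le (hk.1.mul (mFourier m).continuous.aestronglyMeasurable)
    (ae_of_all _ fun t => by rw [norm_mul, norm_mFourier_apply, mul_one])

theorem polyToL2_coeFn (p : MvPolynomial (Fin n) ℂ) :
    (polyToL2 n p : UnitAddTorus (Fin n) → ℂ) =ᵐ[torusMeasure n]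
      MvPolynomial.aeval (R := ℂ) (coord (n := n)) p :=
  ContinuousMap.coeFn_toLp (p := 2) (𝕜 := ℂ) (torusMeasure n) _

theorem aeval_coord_monomial (α : Fin n →₀ ℕ) (c : ℂ) (t : UnitAddTorus (Fin n)) :
    MvPolynomial.aeval (R := ℂ) (coord (n := n)) (MvPolynomial.monomial α c) t
      = c * mFourier (fun i => (α i : ℤ)) t := by
  rw [MvPolynomial.aeval_monomial, Finsupp.prod_fintype _ _ (fun _ => pow_zero _)]
  simp [mFourier, coord, ← fourier_one_pow,
    Algebra.algebraMap_eq_smul_one, -fourier_apply]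

/-- An element of `L²` is orthogonal to the Hardy space if it is orthogonal to all monomials. -/
theorem integral_mul_eq_zero_of_mem_hardy {k : UnitAddTorus (Fin n) → ℂ}
    (hk : MemLp k 2 (torusMeasure n))
    (h : ∀ α : Fin n → ℕ, ∫ t, k t * mFourier (fun i => (α i : ℤ)) t ∂torusMeasure n = 0)
    {f : L2 n} (hf : f ∈ hardy n) : ∫ t, k t * f t ∂torusMeasure n = 0 := by
  -- The inner product is conjugate-linear in its first argument, so the bilinear pairing with `k`
  -- is the inner product with `conj k`.
  have hinner : ∀ g : L2 n, inner ℂ (hk.star.toLp _) g = ∫ t, k t * g t ∂torusMeasure n := by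
    intro g
    rw [L2.inner_def]
    refine integral_congr_ae ?_
    filter_upwards [hk.star.coeFn_toLp] with t ht
    rw [ht]
    simp [mul_comm]
  have hle : hardy n ≤ (innerSL ℂ (hk.star.toLp _)).ker := by
    refine Submodule.topologicalClosure_minimal _ ?_ (ContinuousLinearMap.isClosed_ker _)
    rintro _ ⟨p, rfl⟩
    induction p using MvPolynomial.induction_on' with
    | monomial α c =>
      rw [LinearMap.mem_ker]
      change inner ℂ (hk.star.toLp _) (polyToL2 n (MvPolynomial.monomial α c)) = _
      rw [hinner]
      calc ∫ t, k t * polyToL2 n (MvPolynomial.monomial α c) t ∂torusMeasure n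
          = ∫ t, c * (k t * mFourier (fun i => (α i : ℤ)) t) ∂torusMeasure n := by
            refine integral_congr_ae ?_
            filter_upwards [polyToL2_coeFn (MvPolynomial.monomial α c)] with t ht
            rw [ht, aeval_coord_monomial]
            ring
        _ = 0 := by rw [integral_const_mul, h α, mul_zero]
    | add p q hp hq => rw [map_add]; exact Submodule.add_mem _ hp hq
  rw [← hinner]
  exact hle hf

/-- A square integrable function on the torus is determined by its Fourier coefficients. -/
theorem ae_eq_zero_of_integral_mFourier {k : UnitAddTorus (Fin n) → ℂ}
    (hk : MemLp k 2 (torusMeasure n))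
    (h : ∀ m : Fin n → ℤ, ∫ t, k t * mFourier m t ∂torusMeasure n = 0) :
    k =ᵐ[torusMeasure n] 0 := by
  have h0 : (hk.toLp k : L2 n) = 0 := by
    refine (mFourierBasis (d := Fin n)).repr.map_eq_zero_iff.1 ?_
    ext m
    rw [mFourierBasis_repr]
    refine Eq.trans (integral_congr_ae ?_) (h (-m))
    filter_upwards [hk.coeFn_toLp] with t ht
    rw [ht, smul_eq_mul, mul_comm]
  have h1 := hk.coeFn_toLp
  rw [h0] at h1
  exact h1.symm.trans (Lp.coeFn_zero _ _ _)

/-- Characters are products of one-variable functions, so Fubini factors the integral; `g` enters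
only the factor of index `i`, and one vanishing factor suffices. -/
theorem integral_comp_eval_mul_mFourier (g : UnitAddCircle → ℂ) (i : Fin n) (m : Fin n → ℤ) :
    ∫ t, g (t i) * mFourier m t ∂torusMeasure n =
      ∏ j, ∫ s, (if j = i then g s else 1) * fourier (m j) s ∂AddCircle.haarAddCircle := by
  rw [← integral_fintype_prod_eq_prod]
  refine integral_congr_ae (ae_of_all _ fun t => ?_)
  simp [mFourier, Finset.prod_mul_distrib, -fourier_apply, -mul_ite, -ite_mul]

theorem integral_comp_eval_mul_mFourier_eq_zero {g : UnitAddCircle → ℂ} {i : Fin n}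
    {m : Fin n → ℤ} (h : ∫ s, g s * fourier (m i) s ∂AddCircle.haarAddCircle = 0) :
    ∫ t, g (t i) * mFourier m t ∂torusMeasure n = 0 := by
  rw [integral_comp_eval_mul_mFourier]
  exact Finset.prod_eq_zero (Finset.mem_univ i) (by simpa using h)

theorem integral_comp_eval_mul_mFourier_eq_zero_of_ne {g : UnitAddCircle → ℂ} {i j : Fin n}
    {m : Fin n → ℤ} (hij : j ≠ i) (hm : m j ≠ 0) :
    ∫ t, g (t i) * mFourier m t ∂torusMeasure n = 0 := by
  rw [integral_comp_eval_mul_mFourier]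
  exact Finset.prod_eq_zero (Finset.mem_univ j)
    (by simpa [hij] using integral_fourier_eq_zero hm)

variable {θ : ℂ → ℂ}

theorem IsInner.aestronglyMeasurable_comp_eval (h : IsInner θ) (i : Fin n) :
    AEStronglyMeasurable (fun t => boundaryFn θ (t i)) (torusMeasure n) :=
  h.aestronglyMeasurable.comp_quasiMeasurePreserving (Measure.quasiMeasurePreserving_eval _ i)

theorem IsInner.norm_comp_eval (h : IsInner θ) (i : Fin n) :
    ∀ᵐ t ∂torusMeasure n, ‖boundaryFn θ (t i)‖ = 1 :=
  (Measure.quasiMeasurePreserving_eval (fun _ => AddCircle.haarAddCircle) i).ae h.norm_boundaryFn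

theorem IsInner.memLp_comp_eval (h : IsInner θ) (i : Fin n) (p : ℝ≥0∞) :
    MemLp (fun t => boundaryFn θ (t i)) p (torusMeasure n) :=
  MemLp.of_bound (h.aestronglyMeasurable_comp_eval i) 1
    ((h.norm_comp_eval i).mono fun _ ht => ht.le)

/-- A unitary module map commutes with multiplication by monomials. -/
theorem exists_mFourier_mul {S₁ S₂ : Submodule ℂ (L2 n)} {h₁ : IsInvariant S₁}
    {h₂ : IsInvariant S₂} {U : S₁ ≃ₗᵢ[ℂ] S₂}
    (hU : ∀ (i : Fin n) (f : S₁), U (restrictedMul h₁ i f) = restrictedMul h₂ i (U f))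
    (α : Fin n →₀ ℕ) (f : S₁) :
    ∃ g : S₁, (g : L2 n) =ᵐ[torusMeasure n] (fun t => mFourier (fun i => (α i : ℤ)) t * f.1 t) ∧
      (U g : L2 n) =ᵐ[torusMeasure n] fun t => mFourier (fun i => (α i : ℤ)) t * (U f).1 t := by
  have hzero : ∀ t : UnitAddTorus (Fin n),
      mFourier (fun i => (((0 : Fin n →₀ ℕ) i : ℕ) : ℤ)) t = 1 := fun t => by simp [mFourier]
  have hcoord : ∀ (j : Fin n) (t : UnitAddTorus (Fin n)),
      mFourier (fun i => ((Finsupp.single j 1 : Fin n →₀ ℕ) i : ℤ)) t = coord j t := by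
    intro j t
    rw [show (coord j t : ℂ) = fourier 1 (t j) from rfl, ← mFourier_single]
    congr 2
    ext i
    rcases eq_or_ne i j with rfl | hij
    · simp
    · simp [hij]
  have hadd : ∀ (α β : Fin n →₀ ℕ) (t : UnitAddTorus (Fin n)),
      mFourier (fun i => ((α + β) i : ℤ)) t
        = mFourier (fun i => (α i : ℤ)) t * mFourier (fun i => (β i : ℤ)) t := by
    intro α β t
    rw [← mFourier_add]
    congr 2
  induction α using Finsupp.induction_linear generalizing f with
  | zero => exact ⟨f, by simp only [hzero, one_mul]; rfl, by simp only [hzero, one_mul]; rfl⟩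
  | add α β ihα ihβ =>
    obtain ⟨g, hg, hUg⟩ := ihβ f
    obtain ⟨g', hg', hUg'⟩ := ihα g
    refine ⟨g', ?_, ?_⟩
    · filter_upwards [hg, hg'] with t h1 h2
      rw [h2, h1, hadd, mul_assoc]
    · filter_upwards [hUg, hUg'] with t h1 h2
      rw [h2, h1, hadd, mul_assoc]
  | single j k =>
    induction k with
    | zero => exact ⟨f, by simp [mFourier], by simp [mFourier]⟩
    | succ k ih =>
      obtain ⟨g, hg, hUg⟩ := ih
      refine ⟨restrictedMul h₁ j g, ?_, ?_⟩
      · filter_upwards [hg, coordMul_coeFn j g.1] with t h1 h2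
        rw [add_comm k 1, Finsupp.single_add, hadd, hcoord, mul_assoc, ← h1]
        exact h2
      · rw [hU]
        filter_upwards [hUg, coordMul_coeFn j (U g).1] with t h1 h2
        rw [add_comm k 1, Finsupp.single_add, hadd, hcoord, mul_assoc, ← h1]
        exact h2

end Torus

/-! ### The module `S_Θ`: analyticity, absence of nonzero constants, unitary maps. -/

section SumModule

variable {n : ℕ} {Θ : Fin n → ℂ → ℂ}

/-- An element of `L²` is orthogonal to `∑ Θ̃ᵢ H²` if it is orthogonal to all `Θ̃ᵢ z^α`. -/
theorem integral_mul_eq_zero_of_mem_sumModule (hΘ : ∀ i, IsInner (Θ i))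
    {k : UnitAddTorus (Fin n) → ℂ} (hk : MemLp k 2 (torusMeasure n))
    (h : ∀ (i : Fin n) (α : Fin n → ℕ),
      ∫ t, k t * boundaryFn (Θ i) (t i) * mFourier (fun i => (α i : ℤ)) t ∂torusMeasure n = 0)
    {f : L2 n} (hf : f ∈ sumModule Θ) : ∫ t, k t * f t ∂torusMeasure n = 0 := by
  induction hf using Submodule.iSup_induction' with
  | mem i g hg =>
    obtain ⟨f, hf, hgf⟩ := hg
    have hk' : MemLp (fun t => k t * boundaryFn (Θ i) (t i)) 2 (torusMeasure n) := by
      refine hk.of_le (hk.1.mul ((hΘ i).aestronglyMeasurable_comp_eval i)) ?_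
      filter_upwards [(hΘ i).norm_comp_eval i] with t ht
      rw [norm_mul, ht, mul_one]
    rw [← integral_mul_eq_zero_of_mem_hardy hk' (h i) hf]
    refine integral_congr_ae ?_
    filter_upwards [hgf] with t ht
    rw [ht, radialLimit_tilde, mul_assoc]
  | zero =>
    refine integral_eq_zero_of_ae ?_
    filter_upwards [Lp.coeFn_zero ℂ 2 (torusMeasure n)] with t ht
    rw [ht, Pi.zero_apply, mul_zero]
  | add f g _ _ hf hg =>
    have hadd := integral_add (hk.integrable_mul (Lp.memLp f)) (hk.integrable_mul (Lp.memLp g))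
    simp only [Pi.mul_apply, hf, hg, add_zero] at hadd
    rw [← hadd]
    refine integral_congr_ae ?_
    filter_upwards [Lp.coeFn_add f g] with t ht
    rw [ht, Pi.add_apply, mul_add]

/-- The Fourier coefficients of elements of `∑ Θ̃ᵢ H²` vanish off `ℕⁿ`. -/
theorem integral_mul_mFourier_eq_zero_of_mem_sumModule (hΘ : ∀ i, IsInner (Θ i)) {f : L2 n}
    (hf : f ∈ sumModule Θ) {m : Fin n → ℤ} {j : Fin n} (hj : 0 < m j) :
    ∫ t, mFourier m t * f t ∂torusMeasure n = 0 := by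
  refine integral_mul_eq_zero_of_mem_sumModule hΘ
    (MemLp.of_bound (mFourier m).continuous.aestronglyMeasurable 1
      (ae_of_all _ fun t => (norm_mFourier_apply m t).le)) (fun i α => ?_) hf
  have h1 : ∀ t : UnitAddTorus (Fin n),
      mFourier m t * boundaryFn (Θ i) (t i) * mFourier (fun i => (α i : ℤ)) t
        = boundaryFn (Θ i) (t i) * mFourier (m + fun i => (α i : ℤ)) t := by
    intro t
    rw [mFourier_add]
    ring
  simp_rw [h1]
  have hpos : 0 < (m + fun i => (α i : ℤ)) j := by simp only [Pi.add_apply]; omega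
  -- The factor in the variable `j` is the mean of `z ^ l * Θ j`, or of `z ^ l` alone, with `l > 0`;
  -- both are zero.
  rcases eq_or_ne j i with rfl | hij
  · refine integral_comp_eval_mul_mFourier_eq_zero ?_
    lift (m + fun i => (α i : ℤ)) j to ℕ using hpos.le with l hl
    simp_rw [mul_comm (boundaryFn _ _)]
    rw [(hΘ j).integral_fourier_mul, zero_pow (by omega), zero_mul]
  · exact integral_comp_eval_mul_mFourier_eq_zero_of_ne hij hpos.ne'

/-- The constants are not in `∑ Θ̃ᵢ H²`: the function `∏ (1 - conj (Θᵢ(0)) Θᵢ(zᵢ))` is orthogonal to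
that space, but not to the constants. -/
theorem eq_zero_of_ae_eq_const_of_mem_sumModule (hΘ : ∀ i, IsInner (Θ i))
    (hnc : ∀ i, ¬ ∃ c : ℂ, ∀ z ∈ Metric.ball (0 : ℂ) 1, Θ i z = c) {f : L2 n}
    (hf : f ∈ sumModule Θ) {c : ℂ} (hc : f =ᵐ[torusMeasure n] fun _ => c) : c = 0 := by
  -- The conjugate of the function described above, because the pairing is bilinear.
  let u : Fin n → UnitAddCircle → ℂ := fun j s => 1 - Θ j 0 * conj (boundaryFn (Θ j) s)
  have hu : MemLp (fun t : UnitAddTorus (Fin n) => ∏ j, u j (t j)) 2 (torusMeasure n) := by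
    refine MemLp.of_bound ?_ (∏ j, (1 + ‖Θ j 0‖)) ?_
    · refine Finset.aestronglyMeasurable_fun_prod _ fun j _ => ?_
      exact aestronglyMeasurable_const.sub (aestronglyMeasurable_const.mul
        (Complex.continuous_conj.comp_aestronglyMeasurable
          ((hΘ j).aestronglyMeasurable_comp_eval j)))
    · filter_upwards [ae_all_iff.2 fun j => (hΘ j).norm_comp_eval j] with t ht
      rw [norm_prod]
      refine Finset.prod_le_prod (fun _ _ => norm_nonneg _) fun j _ => ?_
      refine (norm_sub_le _ _).trans ?_
      rw [norm_one, norm_mul, RCLike.norm_conj, ht j, mul_one]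
  have horth := integral_mul_eq_zero_of_mem_sumModule hΘ hu (fun i α => ?_) hf
  · have hint : ∫ t, ∏ j, u j (t j) ∂torusMeasure n = ∏ j, (1 - Θ j 0 * conj (Θ j 0)) := by
      rw [integral_fintype_prod_eq_prod]
      refine Finset.prod_congr rfl fun j _ => ?_
      have hb := ((hΘ j).memLp 1).integrable le_rfl
      have hb' : Integrable (fun s => conj (boundaryFn (Θ j) s)) AddCircle.haarAddCircle :=
        ((hΘ j).memLp 1).star.integrable le_rfl
      have hmean := (hΘ j).integral_fourier_mul 0
      simp only [Nat.cast_zero, fourier_zero, one_mul, pow_zero] at hmean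
      rw [integral_sub (integrable_const _) (hb'.const_mul _), integral_const_mul, integral_conj,
        hmean]
      simp
    have h1 : ∫ t, (∏ j, u j (t j)) * f t ∂torusMeasure n
        = (∏ j, (1 - Θ j 0 * conj (Θ j 0))) * c := by
      rw [← hint, ← integral_mul_const]
      refine integral_congr_ae ?_
      filter_upwards [hc] with t ht
      rw [ht]
    rw [h1] at horth
    refine (mul_eq_zero.1 horth).resolve_left (Finset.prod_ne_zero_iff.2 fun j _ h0 => ?_)
    rw [Complex.mul_conj, Complex.normSq_eq_norm_sq, sub_eq_zero] at h0
    have h2 : ‖Θ j 0‖ ^ 2 = 1 := by exact_mod_cast h0.symm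
    exact (hΘ j).norm_apply_zero_ne_one (hnc j)
      ((pow_eq_one_iff_of_nonneg (norm_nonneg _) two_ne_zero).1 h2)
  · have h1 : ∀ t : UnitAddTorus (Fin n),
        (∏ j, u j (t j)) * boundaryFn (Θ i) (t i) * mFourier (fun i => (α i : ℤ)) t
          = ∏ j, (u j (t j) * (if j = i then boundaryFn (Θ i) (t j) else 1)
              * fourier (α j : ℤ) (t j)) := by
      intro t
      rw [Finset.prod_mul_distrib, Finset.prod_mul_distrib, Finset.prod_ite_eq' Finset.univ i]
      simp [mFourier]
    simp_rw [h1]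
    rw [integral_fintype_prod_eq_prod (fun j s =>
      u j s * (if j = i then boundaryFn (Θ i) s else 1) * fourier (α j : ℤ) s)]
    refine Finset.prod_eq_zero (Finset.mem_univ i) ?_
    -- As `Θ i` is unimodular on the circle, `u i * Θ i = Θ i - Θ i 0`. This is analytic and
    -- vanishes at the origin, so its product with any `z ^ α i` has mean zero.
    have h2 : ∀ᵐ s ∂AddCircle.haarAddCircle,
        u i s * (if i = i then boundaryFn (Θ i) s else 1) * fourier (α i : ℤ) s
          = fourier (α i : ℤ) s * boundaryFn (Θ i) s - Θ i 0 * fourier (α i : ℤ) s := by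
      filter_upwards [(hΘ i).norm_boundaryFn] with s hs
      have h3 : conj (boundaryFn (Θ i) s) * boundaryFn (Θ i) s = 1 := by
        rw [← Complex.normSq_eq_conj_mul_self, Complex.normSq_eq_norm_sq, hs]
        simp
      rw [if_pos rfl]
      linear_combination (-Θ i 0 * fourier (α i : ℤ) s) * h3
    have hfi : Integrable (fun s : UnitAddCircle => (fourier (α i : ℤ) s : ℂ))
        AddCircle.haarAddCircle :=
      (fourier (α i : ℤ)).continuous.integrable_of_hasCompactSupport
        (HasCompactSupport.of_compactSpace _)
    have hbi : Integrable (fun s => fourier (α i : ℤ) s * boundaryFn (Θ i) s)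
        AddCircle.haarAddCircle :=
      (((hΘ i).memLp 1).integrable le_rfl).bdd_mul (c := 1)
        (fourier (α i : ℤ)).continuous.aestronglyMeasurable
        (ae_of_all _ fun s => (norm_fourier_apply _ s).le)
    rw [integral_congr_ae h2, integral_sub hbi (hfi.const_mul _), integral_const_mul,
      (hΘ i).integral_fourier_mul]
    rcases eq_or_ne (α i) 0 with h0 | h0
    · simp [h0]
    · rw [integral_fourier_eq_zero (by exact_mod_cast h0), zero_pow h0]
      simp

/-- If all Fourier coefficients of `f` with nonzero index vanish, then `f` is constant. -/
theorem ae_eq_const_of_integral_mFourier {f : UnitAddTorus (Fin n) → ℂ}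
    (hf : MemLp f 2 (torusMeasure n))
    (h : ∀ m : Fin n → ℤ, m ≠ 0 → ∫ t, f t * mFourier m t ∂torusMeasure n = 0) :
    f =ᵐ[torusMeasure n] fun _ => ∫ t, f t ∂torusMeasure n := by
  have h0 := ae_eq_zero_of_integral_mFourier
    (hf.sub (memLp_const (∫ t, f t ∂torusMeasure n))) (fun m => ?_)
  · filter_upwards [h0] with t ht
    exact sub_eq_zero.1 ht
  · have hi := (memLp_mul_mFourier hf m).integrable one_le_two
    have hi' := (memLp_mul_mFourier (memLp_const (μ := torusMeasure n) (p := 2)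
      (∫ t, f t ∂torusMeasure n)) m).integrable one_le_two
    simp only [Pi.sub_apply, sub_mul]
    rw [integral_sub hi hi', integral_const_mul]
    rcases eq_or_ne m 0 with rfl | hm
    · simp [mFourier_zero]
    · obtain ⟨j, hj⟩ := Function.ne_iff.1 hm
      have h1 := integral_comp_eval_mul_mFourier_eq_zero (g := fun _ => 1) (i := j) (m := m)
        (by simpa only [one_mul] using integral_fourier_eq_zero hj)
      simp only [one_mul] at h1
      rw [h m hm, h1, mul_zero, sub_zero]

/-- A unitary module map `U` from `∑ Θ̃ᵢ H²` onto `H²` satisfies `conj (U⁻¹ 1) Θ̃ᵢ = U Θ̃ᵢ`. -/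
theorem conj_mul_ae_eq_of_unitary (hΘ : ∀ i, IsInner (Θ i)) {S₂ : Submodule ℂ (L2 n)}
    {h₂ : IsInvariant S₂} {U : sumModule Θ ≃ₗᵢ[ℂ] S₂}
    (hU : ∀ (i : Fin n) (f : sumModule Θ),
      U (restrictedMul (isInvariant_sumModule Θ) i f) = restrictedMul h₂ i (U f))
    {i : Fin n} {ψ e : sumModule Θ} (hψ : (U ψ : L2 n) =ᵐ[torusMeasure n] fun _ => 1)
    (he : (e : L2 n) =ᵐ[torusMeasure n] fun t => boundaryFn (Θ i) (t i)) :
    (fun t => conj (ψ.1 t) * boundaryFn (Θ i) (t i)) =ᵐ[torusMeasure n] (U e : L2 n) := by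
  have hψi : MemLp (fun t => conj (ψ.1 t) * boundaryFn (Θ i) (t i)) 2 (torusMeasure n) := by
    refine (Lp.memLp ψ.1).of_le ((Complex.continuous_conj.comp_aestronglyMeasurable
      (Lp.memLp ψ.1).1).mul ((hΘ i).aestronglyMeasurable_comp_eval i)) ?_
    filter_upwards [(hΘ i).norm_comp_eval i] with t ht
    rw [norm_mul, ht, mul_one, RCLike.norm_conj]
  have h0 := ae_eq_zero_of_integral_mFourier (hψi.sub (Lp.memLp (U e).1)) (fun m => ?_)
  · filter_upwards [h0] with t ht
    exact sub_eq_zero.1 ht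
  · simp only [Pi.sub_apply, sub_mul]
    rw [integral_sub ((memLp_mul_mFourier hψi m).integrable one_le_two)
      ((memLp_mul_mFourier (Lp.memLp (U e).1) m).integrable one_le_two), sub_eq_zero]
    -- Only nonnegative powers act on the modules, so `m` is split into positive and negative parts:
    -- `z^(m⁻)` acts on `ψ`, `z^(m⁺)` on `e`, and conjugation in the inner product reassembles
    -- `z^m`.
    obtain ⟨g, hg, hUg⟩ := exists_mFourier_mul hU
      (Finsupp.equivFunOnFinite.symm fun i => (-m i).toNat) ψ
    obtain ⟨g', hg', hUg'⟩ := exists_mFourier_mul hU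
      (Finsupp.equivFunOnFinite.symm fun i => (m i).toNat) e
    have hinner := U.inner_map_map g g'
    rw [Submodule.coe_inner, Submodule.coe_inner, L2.inner_def, L2.inner_def] at hinner
    have hm : ∀ t : UnitAddTorus (Fin n), mFourier m t =
        mFourier (fun i => ((m i).toNat : ℤ)) t * conj (mFourier (fun i => ((-m i).toNat : ℤ)) t) := by
      intro t
      rw [← mFourier_neg, ← mFourier_add]
      congr 2
      ext i
      simp only [Pi.add_apply, Pi.neg_apply]
      omega
    refine Eq.trans ?_ (hinner.symm.trans ?_)
    · refine integral_congr_ae ?_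
      filter_upwards [hg, hg', he] with t h1 h2 h3
      rw [h1, h2, h3, RCLike.inner_apply, hm, map_mul]
      simp only [Finsupp.equivFunOnFinite_symm_apply_apply]
      ring
    · refine integral_congr_ae ?_
      filter_upwards [hUg, hUg', hψ] with t h1 h2 h3
      rw [h1, h2, h3, RCLike.inner_apply, hm, map_mul]
      simp only [Finsupp.equivFunOnFinite_symm_apply_apply, map_one]
      ring

end SumModule

end HardyPolydisc

end

/-! ### The main theorem. -/

open HardyPolydisc

theorem mainTheorem10 (n : ℕ) (hn : 2 ≤ n) (Θ : Fin n → ℂ → ℂ)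
    (hinner : ∀ i, HardyPolydisc.IsInner (Θ i))
    (hnonconst : ∀ i, ¬ ∃ c : ℂ, ∀ z ∈ Metric.ball (0 : ℂ) 1, Θ i z = c) :
    ¬ HardyPolydisc.UnitarilyEquivalent (HardyPolydisc.sumModule Θ) (HardyPolydisc.hardy n)
        (HardyPolydisc.isInvariant_sumModule Θ) (HardyPolydisc.isInvariant_hardy n) := by
  rintro ⟨U, hU⟩
  have hone_mem : polyToL2 n 1 ∈ hardy n := Submodule.le_topologicalClosure _ ⟨1, rfl⟩
  have hone : (polyToL2 n 1 : L2 n) =ᵐ[torusMeasure n] fun _ => 1 := by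
    filter_upwards [polyToL2_coeFn (n := n) 1] with t ht
    rw [ht, map_one, ContinuousMap.one_apply]
  obtain ⟨ψ, hψ⟩ := U.surjective ⟨polyToL2 n 1, hone_mem⟩
  have hUψ : (U ψ : L2 n) =ᵐ[torusMeasure n] fun _ => 1 := by rw [hψ]; exact hone
  -- Here `F = U Θ̃ᵢ`; the unimodular factor `Θ̃ᵢ` is moved across by multiplying with its
  -- conjugate.
  have hkey : ∀ i, ∃ F ∈ hardy n, (fun t => conj (ψ.1 t)) =ᵐ[torusMeasure n]
      fun t => conj (boundaryFn (Θ i) (t i)) * F t := by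
    intro i
    have hb := (hinner i).memLp_comp_eval i 2
    have he_mem : (hb.toLp _ : L2 n) ∈ sumModule Θ := by
      refine Submodule.mem_iSup_of_mem i ⟨polyToL2 n 1, hone_mem, ?_⟩
      filter_upwards [hb.coeFn_toLp, hone] with t h1 h2
      rw [h1, h2, mul_one, radialLimit_tilde]
    refine ⟨_, (U ⟨_, he_mem⟩).2, ?_⟩
    filter_upwards [conj_mul_ae_eq_of_unitary hinner hU hUψ (e := ⟨_, he_mem⟩) hb.coeFn_toLp,
      (hinner i).norm_comp_eval i] with t h1 h2
    have h3 : boundaryFn (Θ i) (t i) * conj (boundaryFn (Θ i) (t i)) = 1 := by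
      rw [Complex.mul_conj, Complex.normSq_eq_norm_sq, h2]
      simp
    rw [← h1]
    linear_combination (-conj (ψ.1 t)) * h3
  have hconst := ae_eq_const_of_integral_mFourier (Lp.memLp ψ.1).star (fun m hm => ?_)
  · have hψc : (ψ : L2 n) =ᵐ[torusMeasure n]
        fun _ => star (∫ t, (star (ψ.1 : UnitAddTorus (Fin n) → ℂ)) t ∂torusMeasure n) := by
      filter_upwards [hconst] with t ht
      rw [← ht, Pi.star_apply, star_star]
    rw [eq_zero_of_ae_eq_const_of_mem_sumModule hinner hnonconst ψ.2 hψc] at hψc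
    have hψ0 : ψ = 0 := Subtype.ext (Lp.ext (hψc.trans (Lp.coeFn_zero _ _ _).symm))
    rw [hψ0, map_zero] at hUψ
    obtain ⟨t, h1, h2⟩ := (hUψ.and (Lp.coeFn_zero ℂ 2 (torusMeasure n))).exists
    exact one_ne_zero (h1.symm.trans h2)
  · obtain ⟨j, hj⟩ := Function.ne_iff.1 hm
    rcases lt_or_gt_of_ne hj with hj | hj
    -- For `m j < 0` the integral is the conjugate of a pairing of `ψ` with `z^(-m)`, which vanishes
    -- by analyticity of `ψ`.
    · have h1 := integral_mul_mFourier_eq_zero_of_mem_sumModule hinner ψ.2 (m := -m) (j := j)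
        (by simpa using hj)
      have h2 := congrArg conj h1
      rw [← integral_conj, map_zero] at h2
      rw [← h2]
      refine integral_congr_ae (ae_of_all _ fun t => ?_)
      simp [mFourier_neg, mul_comm]
    -- For `m j > 0` an index `i ≠ j` is needed: then `conj Θ̃ᵢ` does not involve `z_j`, and each
    -- monomial of `F` times `z^m` has a positive power of `z_j`, so it integrates to zero.
    · have : Nontrivial (Fin n) := Fin.nontrivial_iff_two_le.2 hn
      obtain ⟨i, hij⟩ := exists_ne j
      obtain ⟨F, hF, hψF⟩ := hkey i
      have hk := memLp_mul_mFourier ((hinner i).memLp_comp_eval i 2).star m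
      rw [← integral_mul_eq_zero_of_mem_hardy hk (fun α => ?_) hF]
      · refine integral_congr_ae ?_
        filter_upwards [hψF] with t ht
        change conj (ψ.1 t) * _ = conj _ * _ * _
        rw [ht]
        ring
      · have hpos : (m + fun i => (α i : ℤ)) j ≠ 0 := by
          simp only [Pi.add_apply, Pi.zero_apply] at hj ⊢
          omega
        rw [← integral_comp_eval_mul_mFourier_eq_zero_of_ne
          (g := fun s => conj (boundaryFn (Θ i) s)) hij.symm hpos]
        refine integral_congr_ae (ae_of_all _ fun t => ?_)
        simp only [mFourier_add]
        exact mul_assoc _ _ _
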